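/- Let $\Gamma$ be a finite distance-regular graph with valency $k$, diameter $D\ge 3$ and smallest adjacency eigenvalue $\theta_{\min}$ (so $\Gamma$ is connected and, for vertices $x,y$ at distance $i$, the number of neighbours of $y$ at distance $i-1$, respectively $i+1$, from $x$ depends only on $i$). A clique of $\Gamma$ is called a Delsarte clique if it has exactly $1+\frac{k}{-\theta_{\min}}$ vertices. For a vertex $x$ and a set $T$ of vertices put $d(x,T)=\min\{d(x,y)\mid y\in T\}$. It is known that, for a Delsarte clique $C$ and a vertex $x$ with $d(x,C)=1$, the number of vertices of $C$ adjacent to $x$ is a constant $\phi_1$, independent of $x$ and $C$. Assume that $\Gamma$ is geometric with respect to a set $\mathcal C$ of Delsarte cliques, that is, every edge of $\Gamma$ lies in a unique member of $\mathcal C$; call the members of $\mathcal C$ lines. For vertices $x,y$ at distance $2$ let $[x,y]$ be the set of lines $\ell$ containing $x$ with $d(y,\ell)=1$. Assume that $\phi_1\ge 2$ and that $\Gamma$ has the equal line set (ELS) property: for every vertex $x$ and every line $\ell$ with $d(x,\ell)=1$, and for every two distinct vertices $y_1,y_2$ on $\ell$ at distance $2$ from $x$, we have $[x,y_1]=[x,y_2]$.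 Then $\Gamma$ satisfies the dual Pasch axiom: for every two adjacent vertices $x,y$, the set of common neighbours of $x$ and $y$ that do not lie on the line through $x$ and $y$ is a clique. -/

import Mathlib

namespace GeometricDRG

/-- A connected graph is *distance-regular* if there are integers `b i`, `c i` such that for any
two vertices `x`, `y` at distance `i`, the vertex `y` has exactly `c i` neighbours at distance
`i - 1` from `x`, and exactly `b i` neighbours at distance `i + 1` from `x`. -/
def IsDistanceRegular {V : Type*} (G : SimpleGraph V) : Prop :=
  G.Connected ∧ ∃ b c : ℕ → ℕ, ∀ x y : V,
    {z | G.Adj y z ∧ G.dist x z + 1 = G.dist x y}.ncard = c (G.dist x y) ∧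
    {z | G.Adj y z ∧ G.dist x z = G.dist x y + 1}.ncard = b (G.dist x y)

/-- The smallest eigenvalue of the adjacency matrix of a finite graph (the set of real eigenvalues
is finite, and it is nonempty as soon as the graph has a vertex, so that the infimum is
a minimum). -/
noncomputable def smallestEigenvalue {V : Type*} [Fintype V] [DecidableEq V]
    (G : SimpleGraph V) [DecidableRel G.Adj] : ℝ :=
  sInf {θ : ℝ | Module.End.HasEigenvalue (Matrix.toLin' (G.adjMatrix ℝ)) θ}

/-- A *Delsarte clique* of a regular graph of valency `k` is a clique of order
`1 + k / (-θ)`, where `θ` is the smallest eigenvalue. -/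
def IsDelsarteClique {V : Type*} [Fintype V] [DecidableEq V]
    (G : SimpleGraph V) [DecidableRel G.Adj] (C : Finset V) : Prop :=
  G.IsClique (C : Set V) ∧
    ∃ k : ℕ, G.IsRegularOfDegree k ∧ (C.card : ℝ) = 1 + (k : ℝ) / (-smallestEigenvalue G)

/-- `G` is a geometric distance-regular graph with respect to the set `𝒞` of cliques: `G` is
distance-regular, the members of `𝒞` are Delsarte cliques, and every edge lies in a unique
member of `𝒞`. The members of `𝒞` are called *lines*. -/
def IsGeometric {V : Type*} [Fintype V] [DecidableEq V]
    (G : SimpleGraph V) [DecidableRel G.Adj] (𝒞 : Set (Finset V)) : Prop :=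
  IsDistanceRegular G ∧ (∀ C ∈ 𝒞, IsDelsarteClique G C) ∧
    ∀ x y : V, G.Adj x y → ∃! C : Finset V, C ∈ 𝒞 ∧ x ∈ C ∧ y ∈ C

/-- The distance `min {d(x, y) | y ∈ T}` of a vertex `x` to a (nonempty) set `T` of vertices. -/
noncomputable def distTo {V : Type*} (G : SimpleGraph V) (x : V) (T : Finset V) : ℕ :=
  sInf (G.dist x '' (T : Set V))

/-- The parameter `φ_j`: the number of vertices of `C` at distance `j` from `x`, where `C` is a
Delsarte clique and `x` a vertex at distance `j` from `C`. In a distance-regular graph this number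
is the same for all such pairs `(x, C)`, so that the supremum below is that common value. (If the
supremum is at least `m ≥ 1`, this says no more than that some such pair has a number `≥ m`.) -/
noncomputable def phi {V : Type*} [Fintype V] [DecidableEq V]
    (G : SimpleGraph V) [DecidableRel G.Adj] (j : ℕ) : ℕ :=
  sSup {n : ℕ | ∃ (C : Finset V) (x : V), IsDelsarteClique G C ∧ distTo G x C = j ∧
    n = {y | y ∈ C ∧ G.dist x y = j}.ncard}

/-- For vertices `x`, `y` at distance `2`, the set `[x, y]` of the lines that contain `x` and are at
distance `1` from `y`. -/
def linesBetween {V : Type*} (G : SimpleGraph V) (𝒞 : Set (Finset V)) (x y : V) :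
    Set (Finset V) :=
  {l | l ∈ 𝒞 ∧ x ∈ l ∧ distTo G y l = 1}

/-- The *equal line set property*: if the vertex `x` is at distance `1` from the line `l`, and
`y₁ ≠ y₂` are vertices on `l` at distance `2` from `x`, then `[x, y₁] = [x, y₂]`. -/
def EqualLineSet {V : Type*} (G : SimpleGraph V) (𝒞 : Set (Finset V)) : Prop :=
  ∀ (x : V), ∀ l ∈ 𝒞, distTo G x l = 1 →
    ∀ y₁ ∈ l, ∀ y₂ ∈ l, y₁ ≠ y₂ → G.dist x y₁ = 2 → G.dist x y₂ = 2 →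
      linesBetween G 𝒞 x y₁ = linesBetween G 𝒞 x y₂

/-- The *dual Pasch axiom*, for the point graph `G` of a partial linear space with set of
lines `𝒞`: for adjacent `x`, `y`, the common neighbours of `x` and `y` outside the line `l` through
`x` and `y` form a clique. -/
def DualPasch {V : Type*} (G : SimpleGraph V) (𝒞 : Set (Finset V)) : Prop :=
  ∀ x y : V, G.Adj x y → ∃ l ∈ 𝒞, x ∈ l ∧ y ∈ l ∧
    G.IsClique {z | G.Adj x z ∧ G.Adj y z ∧ z ∉ l}

end GeometricDRG

/-!
The Bose–Mesner algebra of `Γ` contains a nonzero `M` with `A M = θ_min M`, and `M` annihilates the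
indicator vectors of Delsarte cliques; comparing entries of `M` shows that `φ₁` is constant. As
`D ≥ 3`, a line in the middle of a geodesic of length `3` has disjoint sets of `φ₁` neighbours of
the two end vertices, so all lines have at least `2 φ₁` vertices.

By the equal line set property, if non-adjacent `x ∈ ℓ` and `y ∈ m` satisfy `d(x, m) = d(y, ℓ) = 1`,
then every vertex of either line is at distance at most `1` from the other; call `ℓ` and `m`
related. The key point is that the lines through `x` related to a line `q ∌ x` meeting a line `k`
through `x` form a block that is determined by `k` and any other line of it. Otherwise the three
lines `k`, `m`, `n` through `x` that witness the failure can be rotated into one another, and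
counting neighbours on them gives a contradiction.

Suppose now that `z`, `z'` are non-adjacent common neighbours of `x`, `y` off the line `xy`. Some
line `n` through `x` is not related to `yz`, hence, by the uniqueness of blocks, not to `yz'`. If
`w ≠ x` is a neighbour of `y` on `n`, then `w` is also adjacent to `z` and `z'`. The blocks at `x`
given by the lines `zw` and `zy` share `xz` and `xz'`, so they are equal; but only the first one
contains `n`.
-/

namespace GeometricDRG

section LineSystem

open scoped Finset

variable {V : Type*} {G : SimpleGraph V} {𝒞 : Set (Finset V)} {φ : ℕ} {a b p v w x y z : V}

/-- The vertex `a` is at distance at most `1` from the set `l`. Unlike `distTo G a l ≤ 1`, this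
fails when `l` is empty or not reachable from `a`. -/
def Near (G : SimpleGraph V) (a : V) (l : Finset V) : Prop :=
  ∃ p ∈ l, a = p ∨ G.Adj a p

/-- Two lines are related if every vertex of either is at distance at most `1` from the other. -/
def Related (G : SimpleGraph V) (l m : Finset V) : Prop :=
  (∀ a ∈ l, Near G a m) ∧ ∀ a ∈ m, Near G a l

lemma Near.of_mem {l : Finset V} (h : a ∈ l) : Near G a l := ⟨a, h, .inl rfl⟩

lemma Near.of_adj {l : Finset V} (h : G.Adj a p) (hp : p ∈ l) : Near G a l := ⟨p, hp, .inr h⟩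

lemma Near.exists_adj {l : Finset V} (h : Near G a l) (ha : a ∉ l) : ∃ p ∈ l, G.Adj a p :=
  let ⟨p, hp, hap⟩ := h
  ⟨p, hp, hap.resolve_left fun hap ↦ ha (hap ▸ hp)⟩

lemma Near.of_isClique {l m : Finset V} (hl : G.IsClique (l : Set V)) (ha : a ∈ l) (hx : x ∈ l)
    (hm : x ∈ m) : Near G a m := by
  obtain rfl | hax := eq_or_ne a x
  · exact .of_mem hm
  · exact .of_adj (hl ha hx hax) hm

lemma dist_eq_two_of_adj_of_adj (hxy : Gᶜ.Adj x y) (hxp : G.Adj x p) (hpy : G.Adj p y) :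
    G.dist x y = 2 := by
  have hle : G.dist x y ≤ 2 := SimpleGraph.dist_le (.cons hxp (.cons hpy .nil))
  have hlt : 1 < G.dist x y :=
    (hxp.reachable.trans hpy.reachable).one_lt_dist_of_ne_of_not_adj hxy.ne hxy.2
  exact le_antisymm hle hlt

/-- The combinatorial properties of the lines of a geometric distance-regular graph of diameter at
least `3` with the equal line set property from which the dual Pasch axiom follows; `φ` plays the
role of `φ₁`. Vertices at distance `2` are encoded as vertices adjacent in the complement `Gᶜ`
whenever the other hypotheses provide a path of length `2`. -/
structure IsLineSystem (G : SimpleGraph V) [DecidableRel G.Adj] (𝒞 : Set (Finset V)) (φ : ℕ) :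
    Prop where
  isClique (l : 𝒞) : G.IsClique (l.1 : Set V)
  exists_line {x y : V} : G.Adj x y → ∃ l : 𝒞, x ∈ l.1 ∧ y ∈ l.1
  eq_of_mem {l m : 𝒞} {x y : V} :
    x ≠ y → x ∈ l.1 → y ∈ l.1 → x ∈ m.1 → y ∈ m.1 → l = m
  card_filter_adj (l : 𝒞) {x : V} : x ∉ l.1 → Near G x l → #{y ∈ l.1 | G.Adj x y} = φ
  two_le : 2 ≤ φ
  two_mul_le_card (l : 𝒞) : 2 * φ ≤ #l.1
  related {l m : 𝒞} {x y : V} :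
    x ∈ l.1 → y ∈ m.1 → Gᶜ.Adj x y → Near G x m → Near G y l → Related G l m
  exists_not_near {x u : V} : G.dist x u = 2 → ∃ n : 𝒞, x ∈ n.1 ∧ ¬ Near G u n

/-- The lines through `x` related to the line `q`. If `x` is not on `q`, but `q` meets a line
through `x`, they form a block of the local linear space at `x`. -/
def block (G : SimpleGraph V) (x : V) (q : 𝒞) : Set 𝒞 :=
  {m | x ∈ m.1 ∧ Related G q m}

namespace IsLineSystem

variable [DecidableRel G.Adj] {l m r : 𝒞}

lemma adj (h : IsLineSystem G 𝒞 φ) (ha : a ∈ l.1) (hb : b ∈ l.1) (hab : a ≠ b) : G.Adj a b :=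
  h.isClique l ha hb hab

lemma notMem_of_compl_adj (h : IsLineSystem G 𝒞 φ) (hv : v ∈ l.1) (hav : Gᶜ.Adj a v) :
    a ∉ l.1 :=
  fun ha ↦ hav.2 (h.adj ha hv hav.ne)

lemma related_of_mem_of_mem (h : IsLineSystem G 𝒞 φ) (hl : x ∈ l.1) (hm : x ∈ m.1) :
    Related G l m :=
  ⟨fun _ ha ↦ .of_isClique (h.isClique l) ha hl hm, fun _ ha ↦ .of_isClique (h.isClique m) ha hm hl⟩

lemma related_of_path (h : IsLineSystem G 𝒞 φ) (hyz : y ∈ l.1) (hz : z ∈ l.1) (hx : x ∈ m.1)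
    (hw : w ∈ m.1) (hzw : Gᶜ.Adj z w) (hzx : G.Adj z x) (hwy : G.Adj w y) : Related G l m :=
  h.related hz hw hzw (.of_adj hzx hx) (.of_adj hwy hyz)

lemma adj_of_not_related (h : IsLineSystem G 𝒞 φ) (hlm : ¬ Related G l m) (ha : a ∈ l.1)
    (hb : b ∈ l.1) (hbm : Near G b m) (hv : v ∈ m.1) (hav : G.Adj a v) : G.Adj b v := by
  by_contra hbv
  have hne : b ≠ v := fun hbv ↦ hlm (h.related_of_mem_of_mem hb (hbv ▸ hv))
  exact hlm (h.related hb hv ⟨hne, hbv⟩ hbm (.of_adj hav.symm ha))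

lemma adj_iff_of_not_near (h : IsLineSystem G 𝒞 φ) (hz : z ∈ l.1) (hzr : ¬ Near G z r)
    (ha : a ∈ r.1) (hb : b ∈ r.1) (hal : Near G a l) (hbl : Near G b l) (hv : v ∈ l.1) :
    G.Adj a v ↔ G.Adj b v :=
  have hrl : ¬ Related G r l := fun hrl ↦ hzr (hrl.2 z hz)
  ⟨h.adj_of_not_related hrl ha hb hbl hv, h.adj_of_not_related hrl hb ha hal hv⟩

/-- Both `a` and `b` have `φ` neighbours on `l`, and `v` is a neighbour of `a` only. -/
lemma exists_adj_compl_adj (h : IsLineSystem G 𝒞 φ) (ha : a ∉ l.1) (hb : Near G b l)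
    (hv : v ∈ l.1) (hav : G.Adj a v) (hbv : Gᶜ.Adj b v) :
    ∃ w ∈ l.1, G.Adj b w ∧ Gᶜ.Adj a w := by
  have hcard : #{w ∈ l.1 | G.Adj a w} ≤ #{w ∈ l.1 | G.Adj b w} :=
    (h.card_filter_adj l ha (.of_adj hav hv)).trans_le
      (h.card_filter_adj l (h.notMem_of_compl_adj hv hbv) hb).ge
  by_contra! hcon
  have hsub : {w ∈ l.1 | G.Adj b w} ⊆ {w ∈ l.1 | G.Adj a w} := by
    intro w hw
    rw [Finset.mem_filter] at hw ⊢
    refine ⟨hw.1, ?_⟩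
    by_contra haw
    exact hcon w hw.1 hw.2 ⟨fun e ↦ ha (e ▸ hw.1), haw⟩
  have hmem : v ∈ ({w ∈ l.1 | G.Adj b w} : Finset V) :=
    Finset.eq_of_subset_of_card_le hsub hcard ▸ Finset.mem_filter.2 ⟨hv, hav⟩
  exact hbv.2 (Finset.mem_filter.1 hmem).2

/-- The two sets of `φ` neighbours on `l` overlap in `v`, so they do not exhaust `l`. -/
lemma exists_compl_adj_compl_adj (h : IsLineSystem G 𝒞 φ) (ha : a ∉ l.1) (hb : b ∉ l.1)
    (hv : v ∈ l.1) (hav : G.Adj a v) (hbv : G.Adj b v) :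
    ∃ w ∈ l.1, Gᶜ.Adj a w ∧ Gᶜ.Adj b w := by
  classical
  by_contra! hcon
  have hcover : l.1 ⊆ {w ∈ l.1 | G.Adj a w} ∪ {w ∈ l.1 | G.Adj b w} := by
    intro w hw
    rw [← Finset.filter_or, Finset.mem_filter]
    refine ⟨hw, or_iff_not_imp_left.2 fun haw ↦ ?_⟩
    by_contra hbw
    exact hcon w hw ⟨fun e ↦ ha (e ▸ hw), haw⟩ ⟨fun e ↦ hb (e ▸ hw), hbw⟩
  have hinter : 0 < #({w ∈ l.1 | G.Adj a w} ∩ {w ∈ l.1 | G.Adj b w}) :=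
    Finset.card_pos.2 ⟨v, by simp [hv, hav, hbv]⟩
  have hunion := Finset.card_union_add_card_inter {w ∈ l.1 | G.Adj a w} {w ∈ l.1 | G.Adj b w}
  rw [h.card_filter_adj l ha (.of_adj hav hv), h.card_filter_adj l hb (.of_adj hbv hv)] at hunion
  have hle := Finset.card_le_card hcover
  have hl := h.two_mul_le_card l
  omega

lemma exists_not_related (h : IsLineSystem G 𝒞 φ) (hx : x ∉ l.1) (hy : y ∈ l.1)
    (hxy : G.Adj x y) : ∃ n : 𝒞, x ∈ n.1 ∧ ¬ Related G l n := by
  obtain ⟨u, hu, hxu, -⟩ := h.exists_compl_adj_compl_adj hx hx hy hxy hxy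
  have hyu : G.Adj y u := h.adj hy hu fun hyu ↦ hxu.2 (hyu ▸ hxy)
  obtain ⟨n, hn, hun⟩ := h.exists_not_near (dist_eq_two_of_adj_of_adj hxu hxy hyu)
  exact ⟨n, hn, fun hln ↦ hun (hln.1 u hu)⟩

lemma exists_ne_adj (h : IsLineSystem G 𝒞 φ) (hy : y ∉ l.1) (hyl : Near G y l) (x : V) :
    ∃ w ∈ l.1, w ≠ x ∧ G.Adj y w := by
  have hcard : 1 < #{w ∈ l.1 | G.Adj y w} := h.two_le.trans_eq (h.card_filter_adj l hy hyl).symm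
  obtain ⟨w, hw, hwx⟩ := Finset.exists_mem_ne hcard x
  rw [Finset.mem_filter] at hw
  exact ⟨w, hw.1, hwx, hw.2⟩

end IsLineSystem

/-- A hypothetical failure of the local linear space axiom at `x`: the lines `q₁`, `q₂` meet in a
vertex `z` of the line `k` through `x`, and a further line `m` through `x` lies in both blocks,
but the line `n` lies only in the block of `q₁`. -/
structure SplitBlocks (G : SimpleGraph V) (x z : V) (k m n q₁ q₂ : 𝒞) : Prop where
  x_mem_k : x ∈ k.1
  z_mem_k : z ∈ k.1
  z_mem_q₁ : z ∈ q₁.1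
  z_mem_q₂ : z ∈ q₂.1
  x_notMem_q₁ : x ∉ q₁.1
  m_ne_k : m ≠ k
  m_mem_block_q₁ : m ∈ block G x q₁
  m_mem_block_q₂ : m ∈ block G x q₂
  n_mem_block_q₁ : n ∈ block G x q₁
  n_notMem_block_q₂ : n ∉ block G x q₂

namespace SplitBlocks

variable {k m n q₁ q₂ l o r : 𝒞}

lemma x_mem_m (c : SplitBlocks G x z k m n q₁ q₂) : x ∈ m.1 := c.m_mem_block_q₁.1

lemma x_mem_n (c : SplitBlocks G x z k m n q₁ q₂) : x ∈ n.1 := c.n_mem_block_q₁.1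

lemma not_related (c : SplitBlocks G x z k m n q₁ q₂) : ¬ Related G q₂ n :=
  fun hn ↦ c.n_notMem_block_q₂ ⟨c.x_mem_n, hn⟩

lemma m_ne_n (c : SplitBlocks G x z k m n q₁ q₂) : m ≠ n := by
  rintro rfl
  exact c.n_notMem_block_q₂ c.m_mem_block_q₂

variable [DecidableRel G.Adj]

lemma adj_x_z (h : IsLineSystem G 𝒞 φ) (c : SplitBlocks G x z k m n q₁ q₂) : G.Adj x z :=
  h.adj c.x_mem_k c.z_mem_k fun hxz ↦ c.x_notMem_q₁ (hxz ▸ c.z_mem_q₁)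

lemma z_notMem_m (h : IsLineSystem G 𝒞 φ) (c : SplitBlocks G x z k m n q₁ q₂) : z ∉ m.1 :=
  fun hz ↦ c.m_ne_k (h.eq_of_mem (c.adj_x_z h).ne c.x_mem_m hz c.x_mem_k c.z_mem_k)

lemma z_notMem_n (h : IsLineSystem G 𝒞 φ) (c : SplitBlocks G x z k m n q₁ q₂) : z ∉ n.1 :=
  fun hz ↦ c.not_related (h.related_of_mem_of_mem c.z_mem_q₂ hz)

lemma not_near (h : IsLineSystem G 𝒞 φ) (c : SplitBlocks G x z k m n q₁ q₂) (ha : a ∈ m.1)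
    (hb : b ∈ n.1) (haz : Gᶜ.Adj a z) (hbz : Gᶜ.Adj b z) (har : a ∈ r.1) (hbr : b ∈ r.1) :
    ¬ Near G z r := by
  intro hzr
  have hr : Related G q₂ r :=
    h.related c.z_mem_q₂ har haz.symm hzr (c.m_mem_block_q₂.2.2 a ha)
  have hzn : Near G z n := .of_adj (c.adj_x_z h).symm c.x_mem_n
  exact c.not_related (h.related c.z_mem_q₂ hb hbz.symm hzn (hr.2 b hbr))

lemma adj_iff (h : IsLineSystem G 𝒞 φ) (c : SplitBlocks G x z k m n q₁ q₂) (ha : a ∈ m.1)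
    (hb : b ∈ n.1) (haz : Gᶜ.Adj a z) (hbz : Gᶜ.Adj b z) (hab : G.Adj a b) (hz : z ∈ l.1)
    (hlm : Related G l m) (hln : Related G l n) (hv : v ∈ l.1) : G.Adj a v ↔ G.Adj b v := by
  obtain ⟨r, har, hbr⟩ := h.exists_line hab
  exact h.adj_iff_of_not_near hz (c.not_near h ha hb haz hbz har hbr) har hbr (hlm.2 a ha)
    (hln.2 b hb) hv

/-- The configuration moves from the vertex `z` of `k` to the vertex `b` of `n`. -/
lemma rotate (h : IsLineSystem G 𝒞 φ) (c : SplitBlocks G x z k m n q₁ q₂) (ha : a ∈ m.1)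
    (hb : b ∈ n.1) (haz : Gᶜ.Adj a z) (hbz : Gᶜ.Adj b z) (hy : y ∈ q₁.1) (hxy : Gᶜ.Adj x y)
    (hyo : y ∈ o.1) (hbo : b ∈ o.1) (har : a ∈ r.1) (hbr : b ∈ r.1) :
    SplitBlocks G x b n m k o r := by
  have hxb : G.Adj x b :=
    h.adj c.x_mem_n hb fun hxb ↦ hbz.2 (hxb ▸ c.adj_x_z h)
  have hxo : Near G x o := .of_adj hxb hbo
  have hkq₁ : Related G q₁ k := h.related_of_mem_of_mem c.z_mem_q₁ c.z_mem_k
  exact {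
    x_mem_k := c.x_mem_n
    z_mem_k := hb
    z_mem_q₁ := hbo
    z_mem_q₂ := hbr
    x_notMem_q₁ := h.notMem_of_compl_adj hyo hxy
    m_ne_k := c.m_ne_n
    m_mem_block_q₁ :=
      ⟨c.x_mem_m, h.related hyo c.x_mem_m hxy.symm (c.m_mem_block_q₁.2.1 y hy) hxo⟩
    m_mem_block_q₂ := ⟨c.x_mem_m, h.related_of_mem_of_mem har ha⟩
    n_mem_block_q₁ := ⟨c.x_mem_k, h.related hyo c.x_mem_k hxy.symm (hkq₁.1 y hy) hxo⟩
    n_notMem_block_q₂ := fun hk ↦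
      c.not_near h ha hb haz hbz har hbr (hk.2.2 z c.z_mem_k) }

lemma exists_rotate (h : IsLineSystem G 𝒞 φ) (c : SplitBlocks G x z k m n q₁ q₂) (ha : a ∈ m.1)
    (haz : G.Adj a z) (hb : b ∈ n.1) (hbz : Gᶜ.Adj b z) (hba : Gᶜ.Adj b a) (hy : y ∈ q₁.1)
    (hby : G.Adj b y) (hxy : Gᶜ.Adj x y) :
    ∃ o r : 𝒞, y ∈ o.1 ∧ SplitBlocks G x b n m k o r := by
  have hbm : Near G b m := .of_isClique (h.isClique n) hb c.x_mem_n c.x_mem_m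
  obtain ⟨a', ha', hba', hza'⟩ := h.exists_adj_compl_adj (c.z_notMem_m h) hbm ha haz.symm hba
  obtain ⟨r, hbr, ha'r⟩ := h.exists_line hba'
  obtain ⟨o, hbo, hyo⟩ := h.exists_line hby
  exact ⟨o, r, hyo, c.rotate h ha' hb hza'.symm hbz hy hxy hyo hbo ha'r hbr⟩

lemma adj_iff_on_q₁ (h : IsLineSystem G 𝒞 φ) (c : SplitBlocks G x z k m n q₁ q₂) (ha : a ∈ m.1)
    (haz : G.Adj a z) (hb : b ∈ n.1) (hbz : Gᶜ.Adj b z) (hba : Gᶜ.Adj b a) (hy : y ∈ q₁.1)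
    (hby : G.Adj b y) (hxy : Gᶜ.Adj x y) : G.Adj a y ↔ G.Adj z y := by
  obtain ⟨o, r, hyo, d⟩ := c.exists_rotate h ha haz hb hbz hba hy hby hxy
  exact d.adj_iff h ha c.z_mem_k hba.symm hbz.symm haz d.z_mem_q₁ d.m_mem_block_q₁.2
    d.n_mem_block_q₁.2 hyo

lemma adj_iff_on_n_and_notMem_q₁ (h : IsLineSystem G 𝒞 φ) (c : SplitBlocks G x z k m n q₁ q₂)
    (ha : a ∈ m.1) (haz : G.Adj a z) (hb : b ∈ n.1) (hbz : Gᶜ.Adj b z) (hba : Gᶜ.Adj b a) :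
    (∀ v ∈ n.1, G.Adj a v ↔ G.Adj z v) ∧ a ∉ q₁.1 := by
  have hbq₁ : Near G b q₁ := c.n_mem_block_q₁.2.2 b hb
  obtain ⟨y, hy, hby, hxy⟩ :=
    h.exists_adj_compl_adj c.x_notMem_q₁ hbq₁ c.z_mem_q₁ (c.adj_x_z h) hbz
  obtain ⟨o, r, -, d⟩ := c.exists_rotate h ha haz hb hbz hba hy hby hxy
  refine ⟨fun v hv ↦ d.adj_iff h ha c.z_mem_k hba.symm hbz.symm haz hb
    (h.related_of_mem_of_mem c.x_mem_n c.x_mem_m) (h.related_of_mem_of_mem c.x_mem_n c.x_mem_k) hv,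
    fun haq₁ ↦ ?_⟩
  exact d.not_near h ha c.z_mem_k hba.symm hbz.symm haq₁ c.z_mem_q₁ hbq₁

theorem false (h : IsLineSystem G 𝒞 φ) (c : SplitBlocks G x z k m n q₁ q₂) : False := by
  have hxz := c.adj_x_z h
  obtain ⟨a, ha, hax, hza⟩ := h.exists_ne_adj (c.z_notMem_m h) (.of_adj hxz.symm c.x_mem_m) x
  have hxa : G.Adj x a := h.adj c.x_mem_m ha hax.symm
  have han : a ∉ n.1 := fun han ↦ c.m_ne_n (h.eq_of_mem hax ha c.x_mem_m han c.x_mem_n)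
  obtain ⟨b, hb, hzb, hab⟩ :=
    h.exists_compl_adj_compl_adj (c.z_notMem_n h) han c.x_mem_n hxz.symm hxa.symm
  obtain ⟨hn, haq₁⟩ := c.adj_iff_on_n_and_notMem_q₁ h ha hza.symm hb hzb.symm hab.symm
  obtain ⟨y, hy, hxy, hay⟩ :=
    h.exists_compl_adj_compl_adj c.x_notMem_q₁ haq₁ c.z_mem_q₁ hxz hza.symm
  obtain ⟨b', hb', hyb', hzb'⟩ := h.exists_adj_compl_adj (c.z_notMem_n h)
    (c.n_mem_block_q₁.2.1 y hy) c.x_mem_n hxz.symm hxy.symm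
  have hab' : Gᶜ.Adj a b' := ⟨fun hab' ↦ han (hab' ▸ hb'), fun hab' ↦ hzb'.2 ((hn b' hb').1 hab')⟩
  have hzy : G.Adj z y := h.adj c.z_mem_q₁ hy fun hzy ↦ hxy.2 (hzy ▸ hxz)
  exact hay.2 ((c.adj_iff_on_q₁ h ha hza.symm hb' hzb'.symm hab'.symm hy hyb'.symm hxy).2 hzy)

end SplitBlocks

namespace IsLineSystem

variable [DecidableRel G.Adj] {k m q₁ q₂ : 𝒞}

theorem block_subset_block (h : IsLineSystem G 𝒞 φ) (hxk : x ∈ k.1) (hzk : z ∈ k.1)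
    (hzq₁ : z ∈ q₁.1) (hzq₂ : z ∈ q₂.1) (hxq₁ : x ∉ q₁.1) (hmk : m ≠ k) (hm₁ : m ∈ block G x q₁)
    (hm₂ : m ∈ block G x q₂) : block G x q₁ ⊆ block G x q₂ :=
  fun _ hn₁ ↦ by_contra fun hn₂ ↦
    SplitBlocks.false h ⟨hxk, hzk, hzq₁, hzq₂, hxq₁, hmk, hm₁, hm₂, hn₁, hn₂⟩

theorem adj_of_common_neighbors (h : IsLineSystem G 𝒞 φ) {l : 𝒞} {z' : V} (hxl : x ∈ l.1)
    (hyl : y ∈ l.1) (hxy : x ≠ y) (hz : z ∉ l.1) (hxz : G.Adj x z) (hyz : G.Adj y z)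
    (hz' : z' ∉ l.1) (hxz' : G.Adj x z') (hyz' : G.Adj y z') (hne : z ≠ z') : G.Adj z z' := by
  by_contra hzz'
  have hzz' : Gᶜ.Adj z z' := ⟨hne, hzz'⟩
  obtain ⟨m, hxm, hzm⟩ := h.exists_line hxz
  obtain ⟨m', hxm', hzm'⟩ := h.exists_line hxz'
  obtain ⟨p, hyp, hzp⟩ := h.exists_line hyz
  obtain ⟨p', hyp', hzp'⟩ := h.exists_line hyz'
  have hxp : x ∉ p.1 := fun hxp ↦ hz (h.eq_of_mem hxy hxp hyp hxl hyl ▸ hzp)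
  have hxp' : x ∉ p'.1 := fun hxp' ↦ hz' (h.eq_of_mem hxy hxp' hyp' hxl hyl ▸ hzp')
  obtain ⟨n, hxn, hpn⟩ := h.exists_not_related hxp hyp (h.adj hxl hyl hxy)
  have hp'n : ¬ Related G p' n := fun hp'n ↦ by
    have hml : m ≠ l := fun hml ↦ hz (hml ▸ hzm)
    have hp'm : Related G p' m := h.related_of_path hyp' hzp' hxm hzm hzz'.symm hxz'.symm hyz.symm
    have hpm : Related G p m := h.related_of_mem_of_mem hzp hzm
    exact hpn (h.block_subset_block hxl hyl hyp' hyp hxp' hml ⟨hxm, hp'm⟩ ⟨hxm, hpm⟩ ⟨hxn, hp'n⟩).2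
  have hyn : y ∉ n.1 := fun hyn ↦ hpn (h.related_of_mem_of_mem hyp hyn)
  obtain ⟨w, hwn, hwx, hyw⟩ := h.exists_ne_adj hyn (.of_adj (h.adj hyl hxl hxy.symm) hxn) x
  have hzw : G.Adj z w := h.adj_of_not_related hpn hyp hzp (.of_adj hxz.symm hxn) hwn hyw
  have hz'w : G.Adj z' w := h.adj_of_not_related hp'n hyp' hzp' (.of_adj hxz'.symm hxn) hwn hyw
  obtain ⟨q, hzq, hwq⟩ := h.exists_line hzw
  have hxq : x ∉ q.1 := fun hxq ↦
    hpn (h.related_of_mem_of_mem hzp (h.eq_of_mem hwx.symm hxq hwq hxn hwn ▸ hzq))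
  have hm'm : m' ≠ m := fun hm'm ↦ hzz'.2 (h.adj hzm (hm'm ▸ hzm') hne)
  have hqm' : Related G q m' := h.related_of_path hwq hzq hxm' hzm' hzz' hxz.symm hz'w
  have hpm' : Related G p m' := h.related_of_path hyp hzp hxm' hzm' hzz' hxz.symm hyz'.symm
  have hqn : Related G q n := h.related_of_mem_of_mem hwq hwn
  exact hpn (h.block_subset_block hxm hzm hzq hzp hxq hm'm ⟨hxm', hqm'⟩ ⟨hxm', hpm'⟩ ⟨hxn, hqn⟩).2

theorem dualPasch (h : IsLineSystem G 𝒞 φ) : DualPasch G 𝒞 := by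
  intro x y hxy
  obtain ⟨l, hxl, hyl⟩ := h.exists_line hxy
  refine ⟨l.1, l.2, hxl, hyl, ?_⟩
  rintro z ⟨hxz, hyz, hz⟩ z' ⟨hxz', hyz', hz'⟩
  exact h.adj_of_common_neighbors hxl hyl hxy.ne hz hxz hyz hz' hxz' hyz'

end IsLineSystem

end LineSystem

section BoseMesner

open Matrix Polynomial
open scoped Finset

variable {V R : Type*} {G : SimpleGraph V}

/-- The entries of `M` depend only on the distance of their indices. For a distance-regular graph
these matrices form the Bose–Mesner algebra. -/
def DistanceDependent (G : SimpleGraph V) (M : Matrix V V R) : Prop :=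
  ∃ g : ℕ → R, ∀ x y, M x y = g (G.dist x y)

lemma DistanceDependent.isSymm {M : Matrix V V R} (hM : DistanceDependent G M) : M.IsSymm := by
  obtain ⟨g, hg⟩ := hM
  exact Matrix.IsSymm.ext fun x y ↦ by rw [hg, hg, SimpleGraph.dist_comm]

lemma DistanceDependent.add [Add R] {M N : Matrix V V R} (hM : DistanceDependent G M)
    (hN : DistanceDependent G N) : DistanceDependent G (M + N) := by
  obtain ⟨g, hg⟩ := hM
  obtain ⟨g', hg'⟩ := hN
  exact ⟨g + g', fun x y ↦ by rw [Matrix.add_apply, hg, hg', Pi.add_apply]⟩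

lemma DistanceDependent.scalar [DecidableEq V] [Fintype V] [Semiring R] (hG : G.Connected)
    (a : R) : DistanceDependent G (Matrix.scalar V a) :=
  ⟨fun i ↦ if i = 0 then a else 0, fun x y ↦ by
    simp only [Matrix.scalar_apply, Matrix.diagonal_apply, hG.dist_eq_zero_iff]⟩

variable [Fintype V] [DecidableRel G.Adj]

lemma IsDistanceRegular.exists_isRegularOfDegree (hG : IsDistanceRegular G) :
    ∃ k, G.IsRegularOfDegree k := by
  obtain ⟨-, b, c, hbc⟩ := hG
  refine ⟨b 0, fun x ↦ ?_⟩
  have hx := (hbc x x).2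
  simp only [SimpleGraph.dist_self, zero_add, SimpleGraph.dist_eq_one_iff_adj, and_self] at hx
  rw [← hx, ← G.card_neighborSet_eq_degree, ← Nat.card_eq_fintype_card]
  rfl

lemma IsDistanceRegular.exists_sum_neighborFinset_eq [AddCommGroup R] (hG : IsDistanceRegular G)
    (f : ℕ → R) :
    ∃ g : ℕ → R, ∀ x y, ∑ z ∈ G.neighborFinset y, f (G.dist x z) = g (G.dist x y) := by
  obtain ⟨k, hk⟩ := hG.exists_isRegularOfDegree
  obtain ⟨-, b, c, hbc⟩ := hG
  refine ⟨fun i ↦ c i • (f (i - 1) - f i) + b i • (f (i + 1) - f i) + k • f i, fun x y ↦ ?_⟩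
  have hterm : ∀ z ∈ G.neighborFinset y, f (G.dist x z) =
      (if G.dist x z + 1 = G.dist x y then f (G.dist x y - 1) - f (G.dist x y) else 0) +
      (if G.dist x z = G.dist x y + 1 then f (G.dist x y + 1) - f (G.dist x y) else 0) +
      f (G.dist x y) := by
    intro z hz
    have hdist := ((G.mem_neighborFinset y z).1 hz).diff_dist_adj (u := x)
    obtain h | h | h : G.dist x z = G.dist x y ∨ G.dist x z = G.dist x y + 1 ∨
      G.dist x z + 1 = G.dist x y := by omega
    · simp [h]
    · simp [h, add_assoc]
    · simp [← h, add_assoc]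
  have hcard (p : V → Prop) [DecidablePred p] :
      #{z ∈ G.neighborFinset y | p z} = {z | G.Adj y z ∧ p z}.ncard := by
    rw [← Set.ncard_coe_finset]
    simp only [Finset.coe_filter, SimpleGraph.mem_neighborFinset]
  rw [Finset.sum_congr rfl hterm, Finset.sum_add_distrib, Finset.sum_add_distrib,
    ← Finset.sum_filter, ← Finset.sum_filter, Finset.sum_const, Finset.sum_const, Finset.sum_const,
    hcard, hcard, (hbc x y).1, (hbc x y).2, G.card_neighborFinset_eq_degree, hk.degree_eq]

lemma DistanceDependent.adjMatrix_mul [NonAssocRing R] (hG : IsDistanceRegular G)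
    {M : Matrix V V R} (hM : DistanceDependent G M) :
    DistanceDependent G (G.adjMatrix R * M) := by
  obtain ⟨f, hf⟩ := hM
  obtain ⟨g, hg⟩ := hG.exists_sum_neighborFinset_eq f
  refine ⟨g, fun x y ↦ ?_⟩
  rw [G.dist_comm, ← hg, SimpleGraph.adjMatrix_mul_apply]
  simp only [hf, G.dist_comm]

variable [DecidableEq V]

lemma DistanceDependent.aeval_adjMatrix [CommRing R] (hG : IsDistanceRegular G) (p : R[X]) :
    DistanceDependent G (aeval (G.adjMatrix R) p) := by
  induction p using Polynomial.induction_on with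
  | C a =>
    rw [aeval_C]
    exact .scalar hG.1 a
  | add p q hp hq =>
    rw [map_add]
    exact hp.add hq
  | monomial n a h =>
    rw [pow_succ', ← mul_assoc, mul_comm (C a), mul_assoc, map_mul, aeval_X]
    exact h.adjMatrix_mul hG

end BoseMesner

section Eigenvalue

open Matrix Polynomial

lemma aeval_mul_of_mul_eq_smul {R A : Type*} [CommRing R] [Ring A] [Algebra R A] {a m : A} {θ : R}
    (h : a * m = θ • m) (p : R[X]) : aeval a p * m = p.eval θ • m := by
  have hp := Module.End.aeval_apply_of_mem_apply_eq_smul (f := Algebra.lmul R A a) (p := p) h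
  rwa [aeval_algHom_apply] at hp

lemma exists_aeval_ne_zero_of_isRoot_minpoly {K A : Type*} [Field K] [Ring A] [Algebra K A] {a : A}
    (ha : IsIntegral K a) {θ : K} (hθ : (minpoly K a).IsRoot θ) :
    ∃ p : K[X], aeval a p ≠ 0 ∧ a * aeval a p = θ • aeval a p := by
  obtain ⟨p, hp⟩ := dvd_iff_isRoot.2 hθ
  have hp₀ : p ≠ 0 := fun hp₀ ↦ minpoly.ne_zero ha (by rw [hp, hp₀, mul_zero])
  refine ⟨p, fun hap ↦ ?_, ?_⟩
  · have hdvd := natDegree_le_of_dvd (minpoly.dvd K a hap) hp₀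
    rw [hp, natDegree_mul (X_sub_C_ne_zero θ) hp₀, natDegree_X_sub_C] at hdvd
    omega
  · have hzero := minpoly.aeval K a
    rwa [hp, map_mul, map_sub, aeval_X, aeval_C, sub_mul, sub_eq_zero, ← Algebra.smul_def] at hzero

lemma mulVec_eq_zero_of_dotProduct_mulVec_eq_zero {n R : Type*} [Fintype n] [CommRing R]
    [LinearOrder R] [IsStrictOrderedRing R] {M : Matrix n n R} {c : R} {v : n → R}
    (hM : M.IsSymm) (hMM : M * M = c • M) (hv : v ⬝ᵥ M *ᵥ v = 0) : M *ᵥ v = 0 := by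
  refine dotProduct_self_eq_zero.1 ?_
  rw [dotProduct_mulVec, ← mulVec_transpose, hM.eq, mulVec_mulVec, hMM, smul_mulVec,
    smul_dotProduct, dotProduct_comm, hv, smul_zero]

variable {V : Type*} {G : SimpleGraph V} [Fintype V] [DecidableRel G.Adj] [DecidableEq V]

lemma exists_distanceDependent_of_hasEigenvalue {K : Type*} [Field K] (hG : IsDistanceRegular G)
    {θ : K} (hθ : Module.End.HasEigenvalue (Matrix.toLin' (G.adjMatrix K)) θ) :
    ∃ M : Matrix V V K, M ≠ 0 ∧ DistanceDependent G M ∧ G.adjMatrix K * M = θ • M ∧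
      ∃ c : K, M * M = c • M := by
  have hroot := Module.End.isRoot_of_hasEigenvalue hθ
  rw [Matrix.minpoly_toLin'] at hroot
  obtain ⟨p, hp, hAp⟩ :=
    exists_aeval_ne_zero_of_isRoot_minpoly (Algebra.IsIntegral.isIntegral _) hroot
  exact ⟨_, hp, .aeval_adjMatrix hG p, hAp, _, aeval_mul_of_mul_eq_smul hAp p⟩

lemma hasEigenvalue_smallestEigenvalue [Nonempty V] :
    Module.End.HasEigenvalue (Matrix.toLin' (G.adjMatrix ℝ)) (smallestEigenvalue G) := by
  have i := Classical.arbitrary V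
  have hmem := (G.isHermitian_adjMatrix ℝ).eigenvalues_mem_spectrum_real i
  rw [← Matrix.spectrum_toLin'] at hmem
  exact Set.Nonempty.csInf_mem ⟨_, Module.End.HasEigenvalue.of_mem_spectrum hmem⟩
    (Module.End.finite_hasEigenvalue _)

end Eigenvalue

section DelsarteClique

open Matrix
open scoped Finset

variable {V : Type*} {G : SimpleGraph V} {C C' : Finset V} {x x' : V}

lemma distTo_eq_one_iff (hG : G.Connected) : distTo G x C = 1 ↔ x ∉ C ∧ Near G x C := by
  constructor
  · intro h
    refine ⟨fun hx ↦ ?_, ?_⟩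
    · have hle : distTo G x C ≤ 0 := Nat.sInf_le ⟨x, hx, SimpleGraph.dist_self⟩
      omega
    · obtain ⟨p, hp, hxp⟩ := Nat.sInf_mem (Nat.nonempty_of_sInf_eq_succ h)
      exact .of_adj (SimpleGraph.dist_eq_one_iff_adj.1 (hxp.trans h)) hp
  · rintro ⟨hx, hxC⟩
    obtain ⟨p, hp, hxp⟩ := hxC.exists_adj hx
    have hmem : 1 ∈ G.dist x '' C := ⟨p, hp, SimpleGraph.dist_eq_one_iff_adj.2 hxp⟩
    refine le_antisymm (Nat.sInf_le hmem) (le_csInf ⟨1, hmem⟩ ?_)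
    rintro _ ⟨y, hy, rfl⟩
    exact hG.pos_dist_of_ne fun hxy ↦ hx (hxy ▸ hy)

lemma dist_eq_two_of_near (hC : G.IsClique (C : Set V)) (hxC : Near G x C) {y : V} (hy : y ∈ C)
    (hxy : Gᶜ.Adj x y) : G.dist x y = 2 := by
  obtain ⟨p, hp, hxp⟩ := hxC.exists_adj fun hx ↦ hxy.2 (hC hx hy hxy.ne)
  exact dist_eq_two_of_adj_of_adj hxy hxp (hC hp hy fun hpy ↦ hxy.2 (hpy ▸ hxp))

lemma sum_dist_eq_of_near [DecidableRel G.Adj] {R : Type*} [NonAssocRing R]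
    (hC : G.IsClique (C : Set V)) (hx : x ∉ C) (hxC : Near G x C) (g : ℕ → R) :
    ∑ y ∈ C, g (G.dist x y) = #{y ∈ C | G.Adj x y} * (g 1 - g 2) + #C * g 2 := by
  have hterm : ∀ y ∈ C, g (G.dist x y) = (if G.Adj x y then g 1 - g 2 else 0) + g 2 := by
    intro y hy
    split_ifs with hxy
    · rw [SimpleGraph.dist_eq_one_iff_adj.2 hxy, sub_add_cancel]
    · rw [dist_eq_two_of_near hC hxC hy ⟨fun e ↦ hx (e ▸ hy), hxy⟩, zero_add]
  rw [Finset.sum_congr rfl hterm, Finset.sum_add_distrib, ← Finset.sum_filter, Finset.sum_const,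
    Finset.sum_const, nsmul_eq_mul, nsmul_eq_mul]

lemma sum_sum_dist_of_isClique {R : Type*} [NonAssocRing R] (hC : G.IsClique (C : Set V))
    (g : ℕ → R) :
    ∑ x ∈ C, ∑ y ∈ C, g (G.dist x y) = #C * (g 0 + (#C - 1) * g 1) := by
  classical
  rw [← nsmul_eq_mul]
  refine Finset.sum_eq_card_nsmul fun x hx ↦ ?_
  have hone : ∀ y ∈ C.erase x, g (G.dist x y) = g 1 := fun y hy ↦ by
    obtain ⟨hyx, hy⟩ := Finset.mem_erase.1 hy
    rw [SimpleGraph.dist_eq_one_iff_adj.2 (hC hx hy hyx.symm)]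
  rw [← Finset.add_sum_erase C _ hx, SimpleGraph.dist_self, Finset.sum_congr rfl hone,
    Finset.sum_const, nsmul_eq_mul, Finset.cast_card_erase_of_mem hx]

variable [Fintype V] [DecidableRel G.Adj]

lemma natCast_mul_eq_of_adjMatrix_mul_eq_smul [Nonempty V] {R : Type*} [NonAssocSemiring R]
    {k : ℕ} {θ : R} {M : Matrix V V R} {g : ℕ → R} (hk : G.IsRegularOfDegree k)
    (hg : ∀ x y, M x y = g (G.dist x y)) (hAM : G.adjMatrix R * M = θ • M) :
    k * g 1 = θ * g 0 := by
  have x := Classical.arbitrary V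
  have hone : ∀ z ∈ G.neighborFinset x, M z x = g 1 := fun z hz ↦ by
    rw [hg, SimpleGraph.dist_eq_one_iff_adj.2 ((G.mem_neighborFinset x z).1 hz).symm]
  have hxx := congr_fun₂ hAM x x
  rwa [SimpleGraph.adjMatrix_mul_apply, Finset.sum_congr rfl hone, Finset.sum_const,
    G.card_neighborFinset_eq_degree, hk.degree_eq, nsmul_eq_mul, Matrix.smul_apply, smul_eq_mul,
    hg, SimpleGraph.dist_self] at hxx

/-- `g` gives the entries of a matrix `M` with `A M = θ M`. The restriction of `M` to `C` has row
sums zero, so that the quadratic form of `M` vanishes on the indicator vector of `C`; as `M` is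
symmetric and `M²` is a multiple of `M`, the vector lies in the kernel of `M`. -/
lemma exists_sum_dist_eq_zero [DecidableEq V] (hG : IsDistanceRegular G) {θ : ℝ} {k : ℕ}
    (hk : G.IsRegularOfDegree k) (hθ₀ : θ ≠ 0)
    (hθ : Module.End.HasEigenvalue (Matrix.toLin' (G.adjMatrix ℝ)) θ) :
    ∃ g : ℕ → ℝ, g 0 ≠ 0 ∧ k * g 1 = θ * g 0 ∧
      ∀ C : Finset V, G.IsClique (C : Set V) → (#C : ℝ) = 1 + k / (-θ) →
        ∀ x, ∑ y ∈ C, g (G.dist x y) = 0 := by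
  have := hG.1.nonempty
  obtain ⟨M, hM₀, hM, hAM, c, hMM⟩ := exists_distanceDependent_of_hasEigenvalue hG hθ
  have hsymm := hM.isSymm
  obtain ⟨g, hg⟩ := hM
  have hg₁ := natCast_mul_eq_of_adjMatrix_mul_eq_smul hk hg hAM
  refine ⟨g, fun hg₀ ↦ hM₀ ?_, hg₁, fun C hC hcard x ↦ ?_⟩
  · ext x y
    have hcol : M *ᵥ Pi.single y 1 = 0 := by
      refine mulVec_eq_zero_of_dotProduct_mulVec_eq_zero hsymm hMM ?_
      rw [mulVec_single_one, single_one_dotProduct, col_apply, hg, SimpleGraph.dist_self, hg₀]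
    rw [mulVec_single_one] at hcol
    exact congr_fun hcol x
  · have hmulVec (x : V) :
        (M *ᵥ fun y ↦ if y ∈ C then 1 else 0) x = ∑ y ∈ C, g (G.dist x y) := by
      simp [mulVec, dotProduct, hg]
    have hrow : g 0 + (#C - 1) * g 1 = 0 := by
      rw [hcard]
      field_simp
      linear_combination -hg₁
    rw [← hmulVec, mulVec_eq_zero_of_dotProduct_mulVec_eq_zero hsymm hMM, Pi.zero_apply]
    simp only [dotProduct, hmulVec, ite_mul, one_mul, zero_mul, Finset.sum_ite_mem,
      Finset.univ_inter]
    rw [sum_sum_dist_of_isClique hC, hrow, mul_zero]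

variable [DecidableEq V]

lemma IsDelsarteClique.card_eq [Nonempty V] (hC : IsDelsarteClique G C) {k : ℕ}
    (hk : G.IsRegularOfDegree k) : (#C : ℝ) = 1 + k / (-smallestEigenvalue G) := by
  obtain ⟨-, k', hk', hcard⟩ := hC
  rwa [← hk.degree_eq (Classical.arbitrary V), hk'.degree_eq]

theorem IsDelsarteClique.card_filter_adj_eq (hG : IsDistanceRegular G)
    (hθ : smallestEigenvalue G ≠ 0) (hC : IsDelsarteClique G C) (hC' : IsDelsarteClique G C')
    (hx : x ∉ C) (hx' : x' ∉ C') (hxC : Near G x C) (hxC' : Near G x' C') :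
    #{y ∈ C | G.Adj x y} = #{y ∈ C' | G.Adj x' y} := by
  have : Nonempty V := ⟨x⟩
  obtain ⟨k, hk⟩ := hG.exists_isRegularOfDegree
  obtain ⟨g, hg₀, hg₁, hg⟩ := exists_sum_dist_eq_zero hG hk hθ hasEigenvalue_smallestEigenvalue
  have hsum := sum_dist_eq_of_near hC.1 hx hxC g
  have hsum' := sum_dist_eq_of_near hC'.1 hx' hxC' g
  rw [hg C hC.1 (hC.card_eq hk)] at hsum
  rw [hg C' hC'.1 (hC'.card_eq hk), hC'.card_eq hk, ← hC.card_eq hk] at hsum'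
  have hg₁₂ : g 1 - g 2 ≠ 0 := fun hg₁₂ ↦ by
    have hcard : (#C : ℝ) ≠ 0 := by
      obtain ⟨p, hp, -⟩ := hxC
      exact_mod_cast Finset.card_ne_zero_of_mem hp
    rw [hg₁₂, mul_zero, zero_add, zero_eq_mul, or_iff_right hcard] at hsum
    rw [sub_eq_zero.1 hg₁₂, hsum, mul_zero, zero_eq_mul] at hg₁
    exact hg₁.elim hθ hg₀
  exact_mod_cast mul_right_cancel₀ hg₁₂ (add_right_cancel (hsum.symm.trans hsum'))

theorem IsDelsarteClique.card_filter_adj_eq_phi (hG : IsDistanceRegular G)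
    (hθ : smallestEigenvalue G ≠ 0) (hC : IsDelsarteClique G C) (hx : x ∉ C) (hxC : Near G x C) :
    #{y ∈ C | G.Adj x y} = phi G 1 := by
  have hncard (C : Finset V) (x : V) :
      {y | y ∈ C ∧ G.dist x y = 1}.ncard = #{y ∈ C | G.Adj x y} := by
    rw [← Set.ncard_coe_finset]
    simp only [Finset.coe_filter, SimpleGraph.dist_eq_one_iff_adj]
  suffices {n : ℕ | ∃ (C : Finset V) (x : V), IsDelsarteClique G C ∧ distTo G x C = 1 ∧
      n = {y | y ∈ C ∧ G.dist x y = 1}.ncard} = {#{y ∈ C | G.Adj x y}} by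
    rw [phi, this, csSup_singleton]
  refine Set.eq_singleton_iff_unique_mem.2
    ⟨⟨C, x, hC, (distTo_eq_one_iff hG.1).2 ⟨hx, hxC⟩, (hncard C x).symm⟩, ?_⟩
  rintro _ ⟨C', x', hC', hx'C', rfl⟩
  obtain ⟨hx', hx'C'⟩ := (distTo_eq_one_iff hG.1).1 hx'C'
  rw [hncard, hC'.card_filter_adj_eq hG hθ hC hx' hx hx'C' hxC]

end DelsarteClique

section Geometric

open scoped Finset

variable {V : Type*} {G : SimpleGraph V} {𝒞 : Set (Finset V)} {l m : Finset V} {a u v w x y : V}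
  {i n : ℕ}

lemma exists_adj_of_dist_eq_succ (h : G.dist u w = n + 1) : ∃ v, G.dist u v = n ∧ G.Adj v w := by
  obtain ⟨p, hp⟩ := SimpleGraph.exists_walk_of_dist_ne_zero (h.trans_ne n.succ_ne_zero)
  have hlen : p.length = n + 1 := hp.trans h
  refine ⟨p.getVert n, ?_, ?_⟩
  · rw [← SimpleGraph.length_eq_dist_of_subwalk hp (p.isSubwalk_take n),
      SimpleGraph.Walk.take_length]
    omega
  · have hadj := p.adj_getVert_succ (i := n) (by omega)
    rwa [← hlen, p.getVert_length] at hadj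

lemma exists_dist_eq_of_le (h : i ≤ G.dist u w) : ∃ v, G.dist u v = i := by
  induction h using Nat.decreasingInduction with
  | self => exact ⟨w, rfl⟩
  | of_succ k _ ih =>
    obtain ⟨v, hv⟩ := ih
    obtain ⟨v', hv', -⟩ := exists_adj_of_dist_eq_succ hv
    exact ⟨v', hv'⟩

lemma IsDistanceRegular.exists_adj_dist_eq_succ [Finite V] (hG : IsDistanceRegular G)
    (huv : G.dist u v = n + 1) (hxy : G.dist x y = n) : ∃ z, G.Adj y z ∧ G.dist x z = n + 1 := by
  obtain ⟨-, b, c, hbc⟩ := hG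
  obtain ⟨w, huw, hwv⟩ := exists_adj_of_dist_eq_succ huv
  have hw : b n ≠ 0 := by
    rw [← huw, ← (hbc u w).2]
    exact Set.ncard_ne_zero_of_mem (a := v) ⟨hwv, by rw [huv, huw]⟩
  rw [← hxy, ← (hbc x y).2] at hw
  obtain ⟨z, hyz, hxz⟩ := Set.nonempty_of_ncard_ne_zero hw
  exact ⟨z, hyz, by rw [hxz, hxy]⟩

lemma dist_le_two_of_near (hl : G.IsClique (l : Set V)) (hxl : Near G x l) (hy : y ∈ l) :
    G.dist x y ≤ 2 := by
  obtain rfl | hxy := eq_or_ne x y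
  · simp
  by_cases hadj : G.Adj x y
  · rw [SimpleGraph.dist_eq_one_iff_adj.2 hadj]
    exact one_le_two
  · exact (dist_eq_two_of_near hl hxl hy ⟨hxy, hadj⟩).le

lemma EqualLineSet.near (hE : EqualLineSet G 𝒞) (hG : G.Connected) (hl : l ∈ 𝒞) (hm : m ∈ 𝒞)
    (hlC : G.IsClique (l : Set V)) (hmC : G.IsClique (m : Set V)) (hx : x ∈ l) (hy : y ∈ m)
    (hxy : Gᶜ.Adj x y) (hxm : Near G x m) (hyl : Near G y l) (ha : a ∈ m) : Near G a l := by
  obtain rfl | hay := eq_or_ne a y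
  · exact hyl
  obtain rfl | hax := eq_or_ne a x
  · exact .of_mem hx
  by_cases hadj : G.Adj a x
  · exact .of_adj hadj hx
  have hxm' : x ∉ m := fun hx ↦ hxy.2 (hmC hx hy hxy.ne)
  have hyl' : y ∉ l := fun hy ↦ hxy.2 (hlC hx hy hxy.ne)
  have heq : linesBetween G 𝒞 x y = linesBetween G 𝒞 x a :=
    hE x m hm ((distTo_eq_one_iff hG).2 ⟨hxm', hxm⟩) y hy a ha hay.symm
      (dist_eq_two_of_near hmC hxm hy hxy)
      (dist_eq_two_of_near hmC hxm ha ⟨hax.symm, fun h ↦ hadj h.symm⟩)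
  have hmem : l ∈ linesBetween G 𝒞 x y := ⟨hl, hx, (distTo_eq_one_iff hG).2 ⟨hyl', hyl⟩⟩
  rw [heq] at hmem
  exact ((distTo_eq_one_iff hG).1 hmem.2.2).2

variable [Fintype V] [DecidableEq V] [DecidableRel G.Adj]

namespace IsGeometric

lemma isClique (hG : IsGeometric G 𝒞) (hl : l ∈ 𝒞) : G.IsClique (l : Set V) :=
  (hG.2.1 l hl).1

lemma card_eq_card (hG : IsGeometric G 𝒞) (hl : l ∈ 𝒞) (hm : m ∈ 𝒞) : #l = #m := by
  have := hG.1.1.nonempty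
  obtain ⟨k, hk⟩ := hG.1.exists_isRegularOfDegree
  exact_mod_cast ((hG.2.1 l hl).card_eq hk).trans ((hG.2.1 m hm).card_eq hk).symm

lemma smallestEigenvalue_ne_zero (hG : IsGeometric G 𝒞) (hxy : G.Adj x y) :
    smallestEigenvalue G ≠ 0 := by
  intro hθ
  obtain ⟨l, hl, hxl, hyl⟩ := (hG.2.2 x y hxy).exists
  obtain ⟨k, -, hcard⟩ := (hG.2.1 l hl).2
  rw [hθ, neg_zero, div_zero, add_zero, Nat.cast_eq_one] at hcard
  exact (Finset.one_lt_card.2 ⟨x, hxl, y, hyl, hxy.ne⟩).ne' hcard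

lemma card_filter_adj_eq_phi (hG : IsGeometric G 𝒞) (hl : l ∈ 𝒞) (hx : x ∉ l)
    (hxl : Near G x l) : #{y ∈ l | G.Adj x y} = phi G 1 := by
  obtain ⟨p, -, hxp⟩ := hxl.exists_adj hx
  exact (hG.2.1 l hl).card_filter_adj_eq_phi hG.1 (hG.smallestEigenvalue_ne_zero hxp) hx hxl

/-- For a geodesic `x, a, b, w` the neighbours of `x` and of `w` on the line through `a` and `b` are
disjoint. -/
lemma two_mul_phi_le_card (hG : IsGeometric G 𝒞) (hxw : G.dist x w = 3) (hl : l ∈ 𝒞) :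
    2 * phi G 1 ≤ #l := by
  obtain ⟨b, hxb, hbw⟩ := exists_adj_of_dist_eq_succ hxw
  obtain ⟨a, hxa, hab⟩ := exists_adj_of_dist_eq_succ hxb
  rw [SimpleGraph.dist_eq_one_iff_adj] at hxa
  obtain ⟨q, hq, haq, hbq⟩ := (hG.2.2 a b hab).exists
  have hxq : Near G x q := .of_adj hxa haq
  have hwq : Near G w q := .of_adj hbw.symm hbq
  have hxq' : x ∉ q := fun hx ↦ by
    have hle := dist_le_two_of_near (hG.isClique hq) hwq hx
    rw [G.dist_comm, hxw] at hle
    omega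
  have hwq' : w ∉ q := fun hw ↦ by
    have hle := dist_le_two_of_near (hG.isClique hq) hxq hw
    omega
  have hdisj : Disjoint {y ∈ q | G.Adj x y} {y ∈ q | G.Adj w y} :=
    Finset.disjoint_filter.2 fun y _ hxy hwy ↦ by
      have hle : G.dist x w ≤ 2 := SimpleGraph.dist_le (.cons hxy (.cons hwy.symm .nil))
      omega
  calc 2 * phi G 1 = #{y ∈ q | G.Adj x y} + #{y ∈ q | G.Adj w y} := by
        rw [hG.card_filter_adj_eq_phi hq hxq' hxq, hG.card_filter_adj_eq_phi hq hwq' hwq, two_mul]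
    _ = #({y ∈ q | G.Adj x y} ∪ {y ∈ q | G.Adj w y}) := (Finset.card_union_of_disjoint hdisj).symm
    _ ≤ #q := Finset.card_le_card
        (Finset.union_subset (Finset.filter_subset _ _) (Finset.filter_subset _ _))
    _ = #l := hG.card_eq_card hq hl

lemma exists_not_near (hG : IsGeometric G 𝒞) (hvw : G.dist v w = 3) (hxu : G.dist x u = 2) :
    ∃ l ∈ 𝒞, x ∈ l ∧ ¬ Near G u l := by
  obtain ⟨z, hxz, huz⟩ := hG.1.exists_adj_dist_eq_succ hvw (G.dist_comm.trans hxu)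
  obtain ⟨l, hl, hxl, hzl⟩ := (hG.2.2 x z hxz).exists
  refine ⟨l, hl, hxl, fun hul ↦ ?_⟩
  have hle := dist_le_two_of_near (hG.isClique hl) hul hzl
  omega

theorem isLineSystem (hG : IsGeometric G 𝒞) (hD : 3 ≤ G.diam) (hφ : 2 ≤ phi G 1)
    (hE : EqualLineSet G 𝒞) : IsLineSystem G 𝒞 (phi G 1) := by
  have := hG.1.1.nonempty
  obtain ⟨v, v', hv'⟩ := G.exists_dist_eq_diam
  obtain ⟨w, hvw⟩ := exists_dist_eq_of_le (hD.trans_eq hv'.symm)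
  have hcl (l : 𝒞) : G.IsClique (l.1 : Set V) := hG.isClique l.2
  exact {
    isClique := hcl
    exists_line := fun {x y} hxy ↦ by
      simpa only [Subtype.exists, exists_prop] using (hG.2.2 x y hxy).exists
    eq_of_mem := fun {l m x y} hxy hxl hyl hxm hym ↦ Subtype.ext <|
      (hG.2.2 x y (hcl l hxl hyl hxy)).unique ⟨l.2, hxl, hyl⟩ ⟨m.2, hxm, hym⟩
    card_filter_adj := fun l _ ↦ hG.card_filter_adj_eq_phi l.2
    two_le := hφ
    two_mul_le_card := fun l ↦ hG.two_mul_phi_le_card hvw l.2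
    related := fun {l m _ _} hx hy hxy hxm hyl ↦
      ⟨fun _ ↦ hE.near hG.1.1 m.2 l.2 (hcl m) (hcl l) hy hx hxy.symm hyl hxm,
        fun _ ↦ hE.near hG.1.1 l.2 m.2 (hcl l) (hcl m) hx hy hxy hxm hyl⟩
    exists_not_near := fun hxu ↦ by
      simpa only [Subtype.exists, exists_prop] using hG.exists_not_near hvw hxu }

end IsGeometric

end Geometric

end GeometricDRG

theorem mainTheorem8 {V : Type*} [Fintype V] [DecidableEq V]
    (G : SimpleGraph V) [DecidableRel G.Adj] (𝒞 : Set (Finset V))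
    (hG : GeometricDRG.IsGeometric G 𝒞)
    (hD : 3 ≤ G.diam)
    (hφ : 2 ≤ GeometricDRG.phi G 1)
    (hELS : GeometricDRG.EqualLineSet G 𝒞) :
    GeometricDRG.DualPasch G 𝒞 :=
  (hG.isLineSystem hD hφ hELS).dualPasch
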